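/- **Theorem.** Consider a knot diagram (the projection to the plane, or to the sphere, of a closed curve with one component, with crossing information) whose only multiple points are exactly one triple crossing and exactly one ordinary (double) crossing. At the ordinary crossing two strands cross transversally and one is marked as the upper one; at the triple crossing three strands pass pairwise transversally through one point and are assigned the heights bottom, middle and top in any of the $6$ possible ways. The diagram represents the knot whose ordinary diagram is obtained by moving one strand of the triple crossing slightly off the intersection point of the other two, so that the triple crossing becomes three ordinary crossings, in each of which the strand of greater height passes over. (The two ways to do this differ by a Reidemeister III move.) Two ordinary diagrams represent the same knot if a finite sequence of planar isotopies (isotopies on the sphere) and Reidemeister moves joins them. Then the knot represented by the diagram is the unknot or a trefoil knot (left-handed or right-handed). -/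

import Mathlib

/-!
# Knot diagrams with ordinary and triple crossings

Knot diagrams are coded by planar diagram codes.  The edges of the projection are
labelled by natural numbers, and each vertex records the labels of the edge ends around it,
in counterclockwise order.  Marked points (vertices with two ends) are allowed: they make it
possible to code the round circle and to write every Reidemeister move as the replacement of
some vertices by others.
-/

namespace TripleKnot

/-- The vertices of a knot diagram, with the labels of their edge ends in counterclockwise order.

* `point a b`: a marked point of the curve, which is not a crossing;
* `cross a b c d`: an ordinary crossing of the strand `a`-`c` with the strand `b`-`d`; the strand
  `a`-`c` is the lower one and `b`-`d` is the upper one;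
* `triple h a b c d e f`: a triple crossing of the strands `a`-`d` (number `0`), `b`-`e`
  (number `1`) and `c`-`f` (number `2`); strand number `i` has the height `h i`, so that the
  heights `0`, `1`, `2` stand for the bottom, middle and top strand. -/
inductive Vertex where
  | point (a b : ℕ) : Vertex
  | cross (a b c d : ℕ) : Vertex
  | triple (h : Equiv.Perm (Fin 3)) (a b c d e f : ℕ) : Vertex
  deriving DecidableEq

namespace Vertex

/-- The labels of the edge ends at a vertex, in counterclockwise order. -/
def ends : Vertex → List ℕ
  | point a b => [a, b]
  | cross a b c d => [a, b, c, d]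
  | triple _ a b c d e f => [a, b, c, d, e, f]

/-- The strands through a vertex: the pairs of opposite edge ends. -/
def strands : Vertex → List (ℕ × ℕ)
  | point a b => [(a, b)]
  | cross a b c d => [(a, c), (b, d)]
  | triple _ a b c d e f => [(a, d), (b, e), (c, f)]

/-- Change the edge labels. -/
def relabel (r : ℕ → ℕ) : Vertex → Vertex
  | point a b => point (r a) (r b)
  | cross a b c d => cross (r a) (r b) (r c) (r d)
  | triple h a b c d e f => triple h (r a) (r b) (r c) (r d) (r e) (r f)

/-- The vertex is a marked point. -/
def isPoint : Vertex → Bool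
  | point _ _ => true
  | _ => false

/-- The vertex is an ordinary ("traditional") crossing. -/
def isCross : Vertex → Bool
  | cross _ _ _ _ => true
  | _ => false

/-- The vertex is a triple crossing. -/
def isTriple : Vertex → Bool
  | triple _ _ _ _ _ _ _ => true
  | _ => false

/-- The ordinary crossing with edge ends `p`, `q`, `r`, `s` in counterclockwise order, in which
the strand `p`-`r` has height `i` and the strand `q`-`s` has height `j`. -/
def crossAt (i j : Fin 3) (p q r s : ℕ) : Vertex :=
  if i < j then cross p q r s else cross q r s p

end Vertex

open Vertex

/-- A code is a list of vertices. -/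
abbrev Code := List Vertex

namespace Code

/-- The labels of all edge ends of a code. -/
def labels (L : Code) : List ℕ := L.flatMap ends

/-- Every edge has exactly two ends. -/
def WellFormed (L : Code) : Prop := ∀ a ∈ L.labels, L.labels.count a = 2

/-- The edges `a` and `b` follow each other on a strand through some vertex. -/
def Consecutive (L : Code) (a b : ℕ) : Prop := ∃ v ∈ L, (a, b) ∈ v.strands

/-- The curve has a single component. -/
def OneComponent (L : Code) : Prop :=
  ∀ a ∈ L.labels, ∀ b ∈ L.labels, Relation.EqvGen L.Consecutive a b

/-- The edge ends (darts) of a code: a vertex and the position of an end at that vertex. -/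
abbrev Dart (L : Code) := (i : Fin L.length) × Fin (L.get i).ends.length

/-- The label of the edge to which an edge end belongs. -/
def Dart.label {L : Code} (d : L.Dart) : ℕ := (L.get d.1).ends.get d.2

/-- The next edge end, counterclockwise, at the same vertex. -/
def Dart.next {L : Code} (d : L.Dart) : L.Dart := ⟨d.1, finRotate _ d.2⟩

/-- One step along the boundary of a face: run along the edge of `d` to its other end `e`, and
turn there to the edge end that follows `e`. -/
def FaceStep (L : Code) (d d' : L.Dart) : Prop :=
  ∃ e : L.Dart, e ≠ d ∧ e.label = d.label ∧ d' = e.next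

/-- The number of faces, that is, of closed walks along the boundaries of faces. -/
noncomputable def numFaces (L : Code) : ℕ := Nat.card (Quot L.FaceStep)

/-- Euler's formula `V - E + F = 2`, with `2 * E` the number of edge ends.  For a curve with one
component it says that the diagram lies on the sphere, equivalently in the plane. -/
def Planar (L : Code) : Prop := 2 * (L.length + L.numFaces) = L.labels.length + 4

end Code

/-- A marked knot diagram: a planar diagram of a closed curve with one component, possibly with
triple crossings and with marked points. -/
structure MarkedDiagram where
  code : Code
  wellFormed : code.WellFormed
  oneComponent : code.OneComponent
  planar : code.Planar

/-- A knot diagram, possibly with triple crossings.  It has no marked points; only the diagram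
without crossings, the round circle, is coded with a single one. -/
structure KnotDiagram extends MarkedDiagram where
  unmarked : ∀ v ∈ code, v.isPoint → code = [v]

/-- Three ordinary crossings that a triple crossing shows when its strand `c`-`f` is moved off the
intersection point of the two others, towards the ends `a` and `b`.  The edges of the small
triangle are `x`, `y`, `z`. -/
def resolution (h : Equiv.Perm (Fin 3)) (a b c d e f x y z : ℕ) : Code :=
  [crossAt (h 0) (h 1) x y d e, crossAt (h 0) (h 2) a z x f, crossAt (h 1) (h 2) b c y z]

/-- The same, with the strand `c`-`f` moved to the other side, towards the ends `d` and `e`. -/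
def resolution' (h : Equiv.Perm (Fin 3)) (a b c d e f x y z : ℕ) : Code :=
  [crossAt (h 0) (h 1) a b x y, crossAt (h 0) (h 2) x c d z, crossAt (h 1) (h 2) y z e f]

/-- The elementary changes of a code that do not change the knot.  They are applied to marked
knot diagrams only (see `MarkedDiagram.SameKnot`); so labels which a move introduces are unused
elsewhere, and a second Reidemeister move never leaves the plane. -/
inductive Move : Code → Code → Prop
  /- The order of the vertices, the names of the edges and the end at which the description of a
  vertex starts are irrelevant. -/
  | perm {L L' : Code} (hL : L.Perm L') : Move L L'
  | relabel (L : Code) (r : ℕ → ℕ) (hr : Function.Injective r) :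
      Move L (L.map (Vertex.relabel r))
  | rotatePoint (L : Code) (a b : ℕ) : Move (point a b :: L) (point b a :: L)
  | rotateCross (L : Code) (a b c d : ℕ) : Move (cross a b c d :: L) (cross c d a b :: L)
  | rotateTriple (L : Code) (h : Equiv.Perm (Fin 3)) (a b c d e f : ℕ) :
      Move (triple h a b c d e f :: L) (triple (h * finRotate 3) b c d e f a :: L)
  /- Forget a marked point that separates two different edges `a` and `b`. -/
  | forget (L : Code) (a b : ℕ) (hab : a ≠ b) :
      Move (point a b :: L) (L.map (Vertex.relabel (Function.update id b a)))
  /- First Reidemeister move: a kink with the loop `c`, of either sign. -/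
  | reidemeister1 (L : Code) (a b c : ℕ) : Move (point a b :: L) (cross a c c b :: L)
  | reidemeister1' (L : Code) (a b c : ℕ) : Move (point a b :: L) (cross c c a b :: L)
  /- Second Reidemeister move: the strand `a`-`b` is pushed over the strand `c`-`d`. -/
  | reidemeister2 (L : Code) (a b c d m n : ℕ) :
      Move (point a b :: point c d :: L) (cross c m n a :: cross n m d b :: L)
  /- Third Reidemeister move: one of three strands of different heights is moved across the
  crossing of the two others. -/
  | reidemeister3 (L : Code) (h : Equiv.Perm (Fin 3)) (a b c d e f x y z : ℕ) :
      Move (resolution h a b c d e f x y z ++ L) (resolution' h a b c d e f x y z ++ L)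
  /- A triple crossing stands for three ordinary crossings. -/
  | resolve (L : Code) (h : Equiv.Perm (Fin 3)) (a b c d e f x y z : ℕ) :
      Move (triple h a b c d e f :: L) (resolution h a b c d e f x y z ++ L)

/-- Two diagrams represent the same knot: a finite sequence of marked diagrams joins them, in which
neighbours differ by a Reidemeister move, the resolution of a triple crossing, a marked point, or
only in the way the diagram is written down. -/
def MarkedDiagram.SameKnot : MarkedDiagram → MarkedDiagram → Prop :=
  Relation.EqvGen fun D D' => Move D.code D'.code

namespace KnotDiagram

/-- The number of ordinary crossings of a diagram. -/
def numCross (D : KnotDiagram) : ℕ := D.code.countP isCross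

/-- The number of triple crossings of a diagram. -/
def numTriple (D : KnotDiagram) : ℕ := D.code.countP isTriple

/-- Two knot diagrams represent the same knot. -/
def SameKnot (D D' : KnotDiagram) : Prop :=
  MarkedDiagram.SameKnot D.toMarkedDiagram D'.toMarkedDiagram

end KnotDiagram

/-- A way to count the classes of a relation: `f` is a complete invariant and `g` picks
representatives. -/
theorem card_quot_eq {α : Type*} {r : α → α → Prop} {k : ℕ} (f : α → Fin k) (g : Fin k → α)
    (hf : ∀ a b, r a b → f a = f b) (hfg : ∀ i, f (g i) = i)
    (hgf : ∀ a, Relation.EqvGen r (g (f a)) a) : Nat.card (Quot r) = k := by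
  have e : Quot r ≃ Fin k :=
    { toFun := Quot.lift f hf
      invFun := fun i => Quot.mk r (g i)
      left_inv := by
        rintro ⟨a⟩
        exact Quot.eqvGen_sound (hgf a)
      right_inv := hfg }
  simpa using Nat.card_congr e

/-- A way to count faces: `s` sends an edge end to the other end of its edge. -/
theorem face_aux {L : Code} {k : ℕ} (f : L.Dart → Fin k) (g : Fin k → L.Dart)
    (s : L.Dart → L.Dart) (n : L.Dart → ℕ)
    (hf : ∀ d e : L.Dart, e ≠ d → e.label = d.label → f d = f e.next)
    (hs : ∀ d : L.Dart, s d ≠ d ∧ (s d).label = d.label)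
    (hfg : ∀ i, f (g i) = i)
    (hgf : ∀ d : L.Dart, (fun d => (s d).next)^[n d] (g (f d)) = d) :
    L.numFaces = k := by
  refine card_quot_eq f g ?_ hfg ?_
  · rintro d _ ⟨e, h1, h2, rfl⟩
    exact hf d e h1 h2
  · intro d
    have key : ∀ (n : ℕ) (d : L.Dart),
        Relation.EqvGen L.FaceStep d ((fun d => (s d).next)^[n] d) := by
      intro n
      induction n with
      | zero => exact fun d => Relation.EqvGen.refl d
      | succ n ih =>
        intro d
        rw [Function.iterate_succ_apply]
        exact Relation.EqvGen.trans _ _ _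
          (Relation.EqvGen.rel _ _ ⟨s d, (hs d).1, (hs d).2, rfl⟩) (ih _)
    have := key (n d) (g (f d))
    rwa [hgf d] at this

/-- The round circle, coded with one marked point. -/
def unknot : KnotDiagram where
  code := [point 0 0]
  wellFormed := by unfold Code.WellFormed; decide
  oneComponent := by
    have h : Code.labels [point 0 0] = [0, 0] := rfl
    intro a ha b hb
    simp only [h, List.mem_cons, List.not_mem_nil, or_false, or_self] at ha hb
    subst ha hb
    exact Relation.EqvGen.refl _
  planar := by
    have h : Code.numFaces [point 0 0] = 2 :=
      face_aux (fun d => ⟨d.2.1 % 2, Nat.mod_lt _ (by norm_num)⟩) (fun i => ⟨0, i⟩)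
        (fun d => d.next) (fun _ => 0) (by decide) (by decide) (by decide) (by decide)
    simp [Code.Planar, h, Code.labels, ends]
  unmarked := by simp

/-- A curve has one component if all its edges are joined to one of them. -/
theorem oneComponent_aux {L : Code} {l : List ℕ} (h : ∀ a ∈ L.labels, a ∈ l) (r : ℕ)
    (hl : ∀ a ∈ l, Relation.EqvGen L.Consecutive r a) : L.OneComponent := fun a ha b hb =>
  Relation.EqvGen.trans _ _ _ (Relation.EqvGen.symm _ _ (hl a (h a ha))) (hl b (h b hb))

theorem numFaces_leftTrefoil : Code.numFaces [cross 1 4 2 5, cross 3 6 4 1, cross 5 2 6 3] = 5 :=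
  have hL : ∀ i : Fin 3, 4 = ((([cross 1 4 2 5, cross 3 6 4 1, cross 5 2 6 3] : Code).get i).ends).length := by decide
  face_aux (L := [cross 1 4 2 5, cross 3 6 4 1, cross 5 2 6 3])
    (fun d => (![![0, 1, 2, 3], ![0, 4, 2, 1], ![0, 3, 2, 4]] : Fin 3 → Fin 4 → Fin 5) d.1
      (Fin.cast (hL d.1).symm d.2))
    (fun i => ⟨(![0, 0, 0, 0, 1] : Fin 5 → Fin 3) i,
      Fin.cast (hL _) ((![0, 1, 2, 3, 1] : Fin 5 → Fin 4) i)⟩)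
    (fun d =>
      ⟨(![![1, 1, 2, 2], ![2, 2, 0, 0], ![0, 0, 1, 1]] : Fin 3 → Fin 4 → Fin 3) d.1
        (Fin.cast (hL d.1).symm d.2),
      Fin.cast (hL _)
        ((![![3, 2, 1, 0], ![3, 2, 1, 0], ![3, 2, 1, 0]] : Fin 3 → Fin 4 → Fin 4) d.1
          (Fin.cast (hL d.1).symm d.2))⟩)
    (fun d => (![![0, 0, 0, 0], ![1, 0, 2, 1], ![2, 1, 1, 1]] : Fin 3 → Fin 4 → ℕ) d.1
      (Fin.cast (hL d.1).symm d.2))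
    (by decide +revert) (by decide +revert) (by decide +revert)
    (by decide +kernel +revert)

/-- The left-handed trefoil, in its diagram with three crossings. -/
def leftTrefoil : KnotDiagram where
  code := [cross 1 4 2 5, cross 3 6 4 1, cross 5 2 6 3]
  wellFormed := by unfold Code.WellFormed; decide
  oneComponent := by
    have c : ∀ a b, (∃ v ∈ ([cross 1 4 2 5, cross 3 6 4 1, cross 5 2 6 3] : Code), (a, b) ∈ v.strands ∨ (b, a) ∈ v.strands) →
        Relation.EqvGen (Code.Consecutive [cross 1 4 2 5, cross 3 6 4 1, cross 5 2 6 3]) a b :=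
      fun a b ⟨v, hv, h⟩ => h.elim (fun h => Relation.EqvGen.rel _ _ ⟨v, hv, h⟩)
        fun h => Relation.EqvGen.symm _ _ (Relation.EqvGen.rel _ _ ⟨v, hv, h⟩)
    have h2 := c 1 2 (by decide)
    have h3 := h2.trans _ _ _ (c 2 3 (by decide))
    have h4 := h3.trans _ _ _ (c 3 4 (by decide))
    have h5 := h4.trans _ _ _ (c 4 5 (by decide))
    have h6 := h5.trans _ _ _ (c 5 6 (by decide))
    refine oneComponent_aux (l := [1, 2, 3, 4, 5, 6]) (by decide) 1 ?_
    simp [h2, h3, h4, h5, h6, Relation.EqvGen.refl]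
  planar := by
    rw [Code.Planar, numFaces_leftTrefoil]
    decide
  unmarked := by simp [isPoint]

theorem numFaces_rightTrefoil : Code.numFaces [cross 4 2 5 1, cross 6 4 1 3, cross 2 6 3 5] = 5 :=
  have hL : ∀ i : Fin 3, 4 = ((([cross 4 2 5 1, cross 6 4 1 3, cross 2 6 3 5] : Code).get i).ends).length := by decide
  face_aux (L := [cross 4 2 5 1, cross 6 4 1 3, cross 2 6 3 5])
    (fun d => (![![0, 1, 2, 3], ![4, 1, 0, 3], ![2, 1, 4, 3]] : Fin 3 → Fin 4 → Fin 5) d.1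
      (Fin.cast (hL d.1).symm d.2))
    (fun i => ⟨(![0, 0, 0, 0, 1] : Fin 5 → Fin 3) i,
      Fin.cast (hL _) ((![0, 1, 2, 3, 0] : Fin 5 → Fin 4) i)⟩)
    (fun d =>
      ⟨(![![1, 2, 2, 1], ![2, 0, 0, 2], ![0, 1, 1, 0]] : Fin 3 → Fin 4 → Fin 3) d.1
        (Fin.cast (hL d.1).symm d.2),
      Fin.cast (hL _)
        ((![![1, 0, 3, 2], ![1, 0, 3, 2], ![1, 0, 3, 2]] : Fin 3 → Fin 4 → Fin 4) d.1
          (Fin.cast (hL d.1).symm d.2))⟩)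
    (fun d => (![![0, 0, 0, 0], ![0, 2, 1, 1], ![1, 1, 1, 2]] : Fin 3 → Fin 4 → ℕ) d.1
      (Fin.cast (hL d.1).symm d.2))
    (by decide +revert) (by decide +revert) (by decide +revert)
    (by decide +kernel +revert)

/-- The right-handed trefoil: the mirror image of `leftTrefoil`, with all crossings changed. -/
def rightTrefoil : KnotDiagram where
  code := [cross 4 2 5 1, cross 6 4 1 3, cross 2 6 3 5]
  wellFormed := by unfold Code.WellFormed; decide
  oneComponent := by
    have c : ∀ a b, (∃ v ∈ ([cross 4 2 5 1, cross 6 4 1 3, cross 2 6 3 5] : Code), (a, b) ∈ v.strands ∨ (b, a) ∈ v.strands) →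
        Relation.EqvGen (Code.Consecutive [cross 4 2 5 1, cross 6 4 1 3, cross 2 6 3 5]) a b :=
      fun a b ⟨v, hv, h⟩ => h.elim (fun h => Relation.EqvGen.rel _ _ ⟨v, hv, h⟩)
        fun h => Relation.EqvGen.symm _ _ (Relation.EqvGen.rel _ _ ⟨v, hv, h⟩)
    have h2 := c 1 2 (by decide)
    have h3 := h2.trans _ _ _ (c 2 3 (by decide))
    have h4 := h3.trans _ _ _ (c 3 4 (by decide))
    have h5 := h4.trans _ _ _ (c 4 5 (by decide))
    have h6 := h5.trans _ _ _ (c 5 6 (by decide))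
    refine oneComponent_aux (l := [1, 2, 3, 4, 5, 6]) (by decide) 1 ?_
    simp [h2, h3, h4, h5, h6, Relation.EqvGen.refl]
  planar := by
    rw [Code.Planar, numFaces_rightTrefoil]
    decide
  unmarked := by simp [isPoint]

end TripleKnot

namespace TripleKnot

open Vertex

/-! The proof is a finite case analysis. One triple and one ordinary crossing have ten edge ends,
hence five edges. Up to renaming, the projection and the choice of upper strand at the ordinary
crossing are recorded by a pairing of ten positions, so only finitely many pairings need inspection.
Turning the triple crossing puts its bottom strand at number `0` (`tame_triple_cross`), and then
just one bit of the heights is left: the order of the other two strands (`resolution_eq`).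

For each pairing that describes a planar curve with one component, and each value of that bit, at
least one of the two resolutions simplifies by removing kinks (first move), removing bigons (second
move) and forgetting marked points, until the round circle or a three-crossing trefoil diagram
remains. The two resolutions differ by a third move, so either one suffices. The kernel evaluates
this search in `checkLabels_pairings`; `tame_of_check` shows that a successful search is a proof,
and `map_idxOf_mem_pairings` that no diagram is missed.

Every code along a chain of moves must itself be a marked diagram. Its three conditions, including
Euler's formula, are therefore turned into a computable test `valid`, justified by `valid_iff`.
Reordering, renaming and turning preserve it, so the search evaluates it only at genuine reductions.
-/

/-! ### Equivalence classes generated by a finite list of pairs. -/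

/-- The representative of `x` among the points joined to it by pairs in a list. -/
def rep : List (ℕ × ℕ) → ℕ → ℕ
  | [], x => x
  | (p, q) :: S, x => if rep S x = rep S p then rep S q else rep S x

theorem eqvGen_rep (S : List (ℕ × ℕ)) (x : ℕ) :
    Relation.EqvGen (fun a b => (a, b) ∈ S) (rep S x) x := by
  induction S generalizing x with
  | nil => exact .refl _
  | cons e S ih =>
    obtain ⟨p, q⟩ := e
    have mono : ∀ {a b}, Relation.EqvGen (fun a b => (a, b) ∈ S) a b →
        Relation.EqvGen (fun a b => (a, b) ∈ (p, q) :: S) a b :=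
      fun h => h.mono fun _ _ h => List.mem_cons_of_mem _ h
    rw [rep]
    split_ifs with h
    · refine (mono (ih q)).trans _ _ _ (.trans _ p _ (.symm _ _ (.rel _ _ (by simp))) ?_)
      refine .trans _ _ _ (.symm _ _ (mono (ih p))) ?_
      rw [← h]
      exact mono (ih x)
    · exact mono (ih x)

theorem rep_eq_of_mem {S : List (ℕ × ℕ)} {a b : ℕ} (h : (a, b) ∈ S) : rep S a = rep S b := by
  induction S with
  | nil => simp at h
  | cons e S ih =>
    obtain ⟨p, q⟩ := e
    simp only [rep]
    rcases List.mem_cons.1 h with h | h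
    · obtain ⟨rfl, rfl⟩ := Prod.mk.inj h
      simp
    · rw [ih h]

/-- Each pair in the list merges two classes by redirecting one representative to the other, so
comparing representatives decides the generated equivalence. Both components and faces are computed
this way. -/
theorem rep_eq_iff {S : List (ℕ × ℕ)} {x y : ℕ} :
    rep S x = rep S y ↔ Relation.EqvGen (fun a b => (a, b) ∈ S) x y := by
  constructor
  · intro h
    refine .trans _ _ _ (.symm _ _ (eqvGen_rep S x)) ?_
    rw [h]
    exact eqvGen_rep S y
  · intro h
    induction h with
    | rel _ _ h => exact rep_eq_of_mem h
    | refl => rfl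
    | symm _ _ _ ih => exact ih.symm
    | trans _ _ _ _ _ ih ih' => exact ih.trans ih'

/-! The next functions are written with recursors, which the kernel evaluates quickly. -/

/-- Look up a key in an association list. -/
def lookup (k : ℕ) (T : List (ℕ × ℕ)) : ℕ :=
  List.rec (motive := fun _ => ℕ) k (fun e _ ih => Bool.rec ih e.2 (Nat.beq e.1 k)) T

/-- Replace the value `a` by `b` in an association list. -/
def replaceVal (a b : ℕ) (T : List (ℕ × ℕ)) : List (ℕ × ℕ) :=
  List.rec (motive := fun _ => List (ℕ × ℕ)) []
    (fun e _ ih => Bool.rec (e :: ih) ((e.1, b) :: ih) (Nat.beq e.2 a)) T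

/-- The association list of `rep S` on the keys `K`. -/
def repTable (K : List ℕ) : List (ℕ × ℕ) → List (ℕ × ℕ)
  | [] => K.map fun x => (x, x)
  | e :: S => replaceVal (lookup e.1 (repTable K S)) (lookup e.2 (repTable K S)) (repTable K S)

theorem beq_eq_false {a b : ℕ} (h : a ≠ b) : Nat.beq a b = false := by
  rw [Bool.eq_false_iff]
  exact fun hc => h (Nat.eq_of_beq_eq_true hc)

theorem lookup_map (g : ℕ → ℕ) {k : ℕ} {K : List ℕ} (hk : k ∈ K) :
    lookup k (K.map fun x => (x, g x)) = g k := by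
  induction K with
  | nil => simp at hk
  | cons a K ih =>
    change Bool.rec (motive := fun _ => ℕ) (lookup k (K.map fun x => (x, g x))) (g a)
      (Nat.beq a k) = g k
    by_cases h : a = k
    · subst h; simp
    · rw [beq_eq_false h]
      exact ih ((List.mem_cons.1 hk).resolve_left (Ne.symm h))

theorem replaceVal_map (a b : ℕ) (g : ℕ → ℕ) (K : List ℕ) :
    replaceVal a b (K.map fun x => (x, g x)) =
      K.map fun x => (x, if g x = a then b else g x) := by
  induction K with
  | nil => rfl
  | cons c K ih =>
    change Bool.rec (motive := fun _ => List (ℕ × ℕ))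
      ((c, g c) :: replaceVal a b (K.map fun x => (x, g x)))
      ((c, b) :: replaceVal a b (K.map fun x => (x, g x))) (Nat.beq (g c) a) = _
    rw [ih]
    by_cases h : g c = a
    · simp [h]
    · simp [beq_eq_false h, h]

/-- Both members of every pair must be keys, because `lookup` returns a missing key unchanged
instead of its representative. -/
theorem repTable_eq {K : List ℕ} {S : List (ℕ × ℕ)} (h : ∀ e ∈ S, e.1 ∈ K ∧ e.2 ∈ K) :
    repTable K S = K.map fun x => (x, rep S x) := by
  induction S with
  | nil => rfl
  | cons e S ih =>
    have he := h e (by simp)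
    rw [repTable, ih fun e he => h e (List.mem_cons_of_mem _ he), lookup_map _ he.1,
      lookup_map _ he.2, replaceVal_map]
    rfl

/-- The number of different values in an association list. -/
def numValues : List (ℕ × ℕ) → ℕ
  | [] => 0
  | e :: T => bif T.any (fun e' => Nat.beq e'.2 e.2) then numValues T else numValues T + 1

theorem numValues_eq (T : List (ℕ × ℕ)) : numValues T = (T.map Prod.snd).toFinset.card := by
  induction T with
  | nil => rfl
  | cons e T ih =>
    rw [numValues, List.map_cons, List.toFinset_cons]
    by_cases h : e.2 ∈ (T.map Prod.snd).toFinset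
    · have : T.any (fun e' => Nat.beq e'.2 e.2) = true := by
        simp only [List.mem_toFinset, List.mem_map] at h
        obtain ⟨e', h1, h2⟩ := h
        exact List.any_eq_true.2 ⟨e', h1, by simp [h2]⟩
      rw [this, cond_true, ih, Finset.insert_eq_of_mem h]
    · have : T.any (fun e' => Nat.beq e'.2 e.2) = false := by
        rw [Bool.eq_false_iff]
        intro hc
        obtain ⟨e', h1, h2⟩ := List.any_eq_true.1 hc
        refine h ?_
        rw [List.mem_toFinset, List.mem_map]
        exact ⟨e', h1, Nat.eq_of_beq_eq_true h2⟩
      rw [this, cond_false, ih, Finset.card_insert_of_notMem h]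

/-! ### A computable test for well-formedness, one component and planarity. -/

/-- The corners of a list of vertices, given by the labels of their ends: the label of an edge end
together with numbers for this end and the next one. -/
def corners (E : List (List ℕ)) : List (ℕ × ℕ × ℕ) :=
  E.zipIdx.flatMap fun e => e.1.zipIdx.map fun a =>
    (a.1, 8 * e.2 + a.2, 8 * e.2 + (a.2 + 1) % e.1.length)

/-- The steps along faces, in terms of the numbers of edge ends. -/
def faceSteps (C : List (ℕ × ℕ × ℕ)) : List (ℕ × ℕ) :=
  List.rec (motive := fun _ => List (ℕ × ℕ)) [] (fun d _ ih =>
    List.rec (motive := fun _ => List (ℕ × ℕ)) ih (fun e _ ih' =>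
      Bool.rec ih' (Bool.rec ((d.2.1, e.2.2) :: ih') ih' (Nat.beq e.2.1 d.2.1))
        (Nat.beq e.1 d.1)) C) C

/-- The number of faces, computed. -/
def faceCount (C : List (ℕ × ℕ × ℕ)) : ℕ :=
  numValues (repTable (C.map fun d => d.2.1) (faceSteps C))

/-- The pairs of opposite ends of the vertices. -/
def opposite (E : List (List ℕ)) : List (ℕ × ℕ) :=
  E.flatMap fun e => (e.take (e.length / 2)).zip (e.drop (e.length / 2))

/-- All values in an association list agree. -/
def isConst : List (ℕ × ℕ) → Bool
  | [] => true
  | e :: T => T.all fun e' => Nat.beq e'.2 e.2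

/-- A computable form of the conditions on a diagram. -/
def validEnds (E : List (List ℕ)) : Bool :=
  E.flatten.all (fun a => Nat.beq (E.flatten.countP (Nat.beq a)) 2) &&
  (isConst (repTable E.flatten (opposite E)) &&
  Nat.beq (2 * (E.length + faceCount (corners E))) (E.flatten.length + 4))

/-- A computable form of the conditions on the code of a marked diagram. -/
def valid (L : Code) : Bool := validEnds (L.map Vertex.ends)

theorem mem_faceSteps {C : List (ℕ × ℕ × ℕ)} {p q : ℕ} : (p, q) ∈ faceSteps C ↔
    ∃ d ∈ C, ∃ e ∈ C, e.1 = d.1 ∧ e.2.1 ≠ d.2.1 ∧ p = d.2.1 ∧ q = e.2.2 := by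
  have inner : ∀ (d : ℕ × ℕ × ℕ) (A : List (ℕ × ℕ)) (B : List (ℕ × ℕ × ℕ)),
      (p, q) ∈ List.rec (motive := fun _ => List (ℕ × ℕ)) A (fun e _ ih' =>
        Bool.rec ih' (Bool.rec ((d.2.1, e.2.2) :: ih') ih' (Nat.beq e.2.1 d.2.1))
          (Nat.beq e.1 d.1)) B ↔
      (∃ e ∈ B, e.1 = d.1 ∧ e.2.1 ≠ d.2.1 ∧ p = d.2.1 ∧ q = e.2.2) ∨ (p, q) ∈ A := by
    intro d A B
    induction B with
    | nil => simp
    | cons e B ih =>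
      simp only [List.mem_cons, exists_eq_or_imp]
      by_cases h1 : e.1 = d.1
      · by_cases h2 : e.2.1 = d.2.1
        · simp only [h1, h2, Nat.beq_refl, ih]
          simp
        · simp only [h1, Nat.beq_refl, beq_eq_false h2, List.mem_cons, ih, Prod.mk.injEq]
          simp [h2, or_assoc]
      · simp only [beq_eq_false h1, ih]
        simp [h1]
  have outer : ∀ B : List (ℕ × ℕ × ℕ),
      (p, q) ∈ List.rec (motive := fun _ => List (ℕ × ℕ)) [] (fun d _ ih =>
        List.rec (motive := fun _ => List (ℕ × ℕ)) ih (fun e _ ih' =>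
          Bool.rec ih' (Bool.rec ((d.2.1, e.2.2) :: ih') ih' (Nat.beq e.2.1 d.2.1))
            (Nat.beq e.1 d.1)) C) B ↔
      ∃ d ∈ B, ∃ e ∈ C, e.1 = d.1 ∧ e.2.1 ≠ d.2.1 ∧ p = d.2.1 ∧ q = e.2.2 := by
    intro B
    induction B with
    | nil => simp
    | cons d B ih => simp only [inner, ih, List.mem_cons, exists_eq_or_imp]
  exact outer C

/-- A number for each edge end. -/
def Code.Dart.key {L : Code} (d : L.Dart) : ℕ := 8 * d.1 + d.2

theorem ends_length_lt (v : Vertex) : v.ends.length < 8 := by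
  cases v <;> simp [ends]

/-- A vertex has at most six ends, so with the factor `8` the key determines vertex and position. -/
theorem key_injective (L : Code) : Function.Injective (Code.Dart.key (L := L)) := by
  rintro ⟨i, j⟩ ⟨i', j'⟩ h
  have hj := j.2.trans (ends_length_lt _)
  have hj' := j'.2.trans (ends_length_lt _)
  simp only [Code.Dart.key] at h
  obtain rfl : i = i' := Fin.ext (by omega)
  obtain rfl : j = j' := Fin.ext (by omega)
  rfl

theorem finRotate_val {n : ℕ} (j : Fin n) : (finRotate n j : ℕ) = (j + 1) % n := by
  cases n with
  | zero => exact j.elim0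
  | succ n => simp [finRotate_apply, Fin.val_add]

theorem mem_corners {L : Code} {c : ℕ × ℕ × ℕ} : c ∈ corners (L.map ends) ↔
    ∃ d : L.Dart, c = (d.label, d.key, d.next.key) := by
  obtain ⟨a, k, k'⟩ := c
  simp only [corners, List.mem_flatMap, List.mem_map, Prod.exists, List.mk_mem_zipIdx_iff_getElem?]
  constructor
  · rintro ⟨E, i, hE, b, j, hb, h⟩
    obtain ⟨hi, rfl⟩ := List.getElem?_eq_some_iff.1 hE
    obtain ⟨hj, rfl⟩ := List.getElem?_eq_some_iff.1 hb
    rw [List.length_map] at hi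
    simp only [List.getElem_map] at hj h
    refine ⟨⟨⟨i, hi⟩, ⟨j, hj⟩⟩, ?_⟩
    rw [← h]
    simp [Code.Dart.label, Code.Dart.key, Code.Dart.next, finRotate_val,
      -finRotate_apply]
  · rintro ⟨⟨i, j⟩, h⟩
    refine ⟨(L.get i).ends, i, by simp, (L.get i).ends.get j, j, by simp, ?_⟩
    rw [h]
    simp [Code.Dart.label, Code.Dart.key, Code.Dart.next, finRotate_val,
      -finRotate_apply]

theorem mem_faceSteps_corners {L : Code} {p q : ℕ} :
    (p, q) ∈ faceSteps (corners (L.map ends)) ↔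
      ∃ d d' : L.Dart, p = d.key ∧ q = d'.key ∧ L.FaceStep d d' := by
  rw [mem_faceSteps]
  constructor
  · rintro ⟨_, hd, _, he, h1, h2, hp, hq⟩
    obtain ⟨d, rfl⟩ := mem_corners.1 hd
    obtain ⟨e, rfl⟩ := mem_corners.1 he
    exact ⟨d, e.next, hp, hq, e, fun h => h2 (by rw [h]), h1, rfl⟩
  · rintro ⟨d, _, rfl, rfl, e, h1, h2, rfl⟩
    exact ⟨_, mem_corners.2 ⟨d, rfl⟩, _, mem_corners.2 ⟨e, rfl⟩, h2,
      fun h => h1 (key_injective L h), rfl, rfl⟩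

theorem rep_key_eq_iff {L : Code} {d d' : L.Dart} :
    rep (faceSteps (corners (L.map ends))) d.key = rep (faceSteps (corners (L.map ends))) d'.key ↔
      Relation.EqvGen L.FaceStep d d' := by
  rw [rep_eq_iff]
  constructor
  -- The generated relation lives on all of `ℕ`; a chain between numbers is either trivial or has
  -- keys of darts at both ends, and then lifts to a chain of darts.
  · have key : ∀ x y, Relation.EqvGen (fun a b => (a, b) ∈ faceSteps (corners (L.map ends))) x y →
        x = y ∨ ∃ d d' : L.Dart, x = d.key ∧ y = d'.key ∧ Relation.EqvGen L.FaceStep d d' := by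
      intro x y h
      induction h with
      | rel _ _ h =>
        obtain ⟨d, d', h1, h2, h3⟩ := mem_faceSteps_corners.1 h
        exact .inr ⟨d, d', h1, h2, .rel _ _ h3⟩
      | refl => exact .inl rfl
      | symm _ _ _ ih =>
        rcases ih with rfl | ⟨d, d', h1, h2, h3⟩
        · exact .inl rfl
        · exact .inr ⟨d', d, h2, h1, .symm _ _ h3⟩
      | trans _ _ _ _ _ ih ih' =>
        rcases ih with rfl | ⟨d, d', h1, h2, h3⟩
        · exact ih'
        · rcases ih' with rfl | ⟨e, e', h1', h2', h3'⟩
          · exact .inr ⟨d, d', h1, h2, h3⟩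
          · obtain rfl := key_injective L (h2.symm.trans h1')
            exact .inr ⟨d, e', h1, h2', h3.trans _ _ _ h3'⟩
    intro h
    rcases key _ _ h with h | ⟨e, e', h1, h2, h3⟩
    · rw [key_injective L h]
      exact .refl _
    · rwa [key_injective L h1, key_injective L h2]
  · intro h
    induction h with
    | rel d d' h => exact .rel _ _ (mem_faceSteps_corners.2 ⟨d, d', rfl, rfl, h⟩)
    | refl => exact .refl _
    | symm _ _ _ ih => exact .symm _ _ ih
    | trans _ _ _ _ _ ih ih' => exact .trans _ _ _ ih ih'

/-- Faces are the classes of darts under face steps, and `rep` separates exactly these classes, so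
its different values on the keys count them. -/
theorem numFaces_eq (L : Code) : L.numFaces = faceCount (corners (L.map ends)) := by
  set S := faceSteps (corners (L.map ends)) with hS
  let F : L.Dart → ℕ := fun d => rep S d.key
  have e : Quot L.FaceStep ≃ Set.range F := by
    refine Equiv.ofBijective (Quot.lift (fun d => ⟨F d, d, rfl⟩) fun d d' h =>
      Subtype.ext (rep_key_eq_iff.2 (.rel _ _ h))) ⟨?_, ?_⟩
    · rintro ⟨d⟩ ⟨d'⟩ h
      exact Quot.eqvGen_sound (rep_key_eq_iff.1 (congrArg Subtype.val h))
    · rintro ⟨_, d, rfl⟩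
      exact ⟨Quot.mk _ d, rfl⟩
  rw [Code.numFaces, Nat.card_congr e, faceCount, numValues_eq, repTable_eq, ← hS,
    ← Set.ncard_coe_finset, Nat.card_coe_set_eq]
  · congr 1
    ext x
    simp only [Set.mem_range, List.map_map, List.coe_toFinset, List.mem_map, mem_corners,
      Set.mem_ofPred_eq, Function.comp_apply, F]
    constructor
    · rintro ⟨d, rfl⟩
      exact ⟨_, ⟨d, rfl⟩, rfl⟩
    · rintro ⟨_, ⟨d, rfl⟩, rfl⟩
      exact ⟨d, rfl⟩
  · rintro ⟨p, q⟩ h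
    obtain ⟨d, d', rfl, rfl, -⟩ := mem_faceSteps_corners.1 h
    exact ⟨List.mem_map.2 ⟨_, mem_corners.2 ⟨d, rfl⟩, rfl⟩,
      List.mem_map.2 ⟨_, mem_corners.2 ⟨d', rfl⟩, rfl⟩⟩

theorem strands_eq (v : Vertex) :
    v.strands = (v.ends.take (v.ends.length / 2)).zip (v.ends.drop (v.ends.length / 2)) := by
  cases v <;> simp [strands, ends]

theorem mem_opposite {L : Code} {a b : ℕ} :
    (a, b) ∈ opposite (L.map ends) ↔ L.Consecutive a b := by
  simp only [opposite, List.mem_flatMap, List.mem_map, exists_exists_and_eq_and, ← strands_eq]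
  rfl

theorem isConst_iff (T : List (ℕ × ℕ)) : isConst T = true ↔ ∀ e ∈ T, ∀ e' ∈ T, e.2 = e'.2 := by
  cases T with
  | nil => simp [isConst]
  | cons e T =>
    simp only [isConst, List.all_eq_true, Nat.beq_eq]
    constructor
    · intro h
      have h' : ∀ x ∈ e :: T, x.2 = e.2 := by simpa using h
      exact fun x hx y hy => (h' x hx).trans (h' y hy).symm
    · exact fun h x hx => h x (List.mem_cons_of_mem _ hx) e List.mem_cons_self

theorem oneComponent_iff (L : Code) :
    isConst (repTable L.labels (opposite (L.map ends))) = true ↔ L.OneComponent := by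
  have hc : (fun a b => (a, b) ∈ opposite (L.map ends)) = L.Consecutive := by
    ext a b
    exact mem_opposite
  rw [isConst_iff, repTable_eq]
  · simp only [List.mem_map, forall_exists_index, and_imp, forall_apply_eq_imp_iff₂, rep_eq_iff, hc]
    rfl
  · rintro ⟨a, b⟩ h
    obtain ⟨v, hv, h⟩ := mem_opposite.1 h
    rw [strands_eq] at h
    have := List.of_mem_zip h
    exact ⟨List.mem_flatMap.2 ⟨v, hv, List.mem_of_mem_take this.1⟩,
      List.mem_flatMap.2 ⟨v, hv, List.mem_of_mem_drop this.2⟩⟩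

/-- The bridge between marked diagrams and kernel evaluation. -/
theorem valid_iff (L : Code) : valid L = true ↔ L.WellFormed ∧ L.OneComponent ∧ L.Planar := by
  have hl : (L.map ends).flatten = L.labels := by
    simp [Code.labels, List.flatMap_def]
  rw [valid, validEnds, Bool.and_eq_true, Bool.and_eq_true, hl, oneComponent_iff, ← numFaces_eq,
    List.length_map, Nat.beq_eq, List.all_eq_true]
  refine and_congr ?_ Iff.rfl
  simp only [Nat.beq_eq, Code.WellFormed, List.count]
  refine forall₂_congr fun a _ => ?_
  rw [List.countP_congr (q := (· == a))]
  intro x _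
  rw [Nat.beq_eq, beq_iff_eq, eq_comm]

/-! ### Validity under reordering, renaming and turning. -/

theorem exists_equiv_get_of_perm {α : Type*} {L L' : List α} (h : L.Perm L') :
    ∃ e : Fin L.length ≃ Fin L'.length, ∀ i, L'.get (e i) = L.get i := by
  induction h with
  | nil => exact ⟨Equiv.refl _, fun i => i.elim0⟩
  | @cons x L₁ L₂ _ ih =>
    obtain ⟨e, he⟩ := ih
    refine ⟨(finSuccEquiv _).trans (e.optionCongr.trans (finSuccEquiv _).symm), ?_⟩
    refine Fin.cases ?_ fun i => ?_
    · simp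
    · simpa using he i
  | swap x y L =>
    refine ⟨Equiv.swap (0 : Fin (L.length + 2)) 1, ?_⟩
    refine Fin.cases ?_ (Fin.cases ?_ fun i => ?_)
    · exact congrArg (List.get (x :: y :: L)) (Equiv.swap_apply_left 0 1)
    · exact congrArg (List.get (x :: y :: L)) (Equiv.swap_apply_right 0 1)
    · exact congrArg (List.get (x :: y :: L)) (Equiv.swap_apply_of_ne_of_ne (Fin.succ_ne_zero _)
        fun h => Fin.succ_ne_zero i (Fin.succ_injective _ h))
  | trans _ _ ih ih' =>
    obtain ⟨e, he⟩ := ih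
    obtain ⟨e', he'⟩ := ih'
    exact ⟨e.trans e', fun i => (he' _).trans (he i)⟩

/-- `v'` is the vertex `v` with the labels changed by `r`, described from another end. -/
structure Turned (r : ℕ → ℕ) (v v' : Vertex) : Prop where
  exists_equiv : ∃ σ : Fin v.ends.length ≃ Fin v'.ends.length,
    (∀ j, v'.ends.get (σ j) = r (v.ends.get j)) ∧
      ∀ j, σ (finRotate _ j) = finRotate _ (σ j)
  ends_perm : v'.ends.Perm (v.ends.map r)
  strands : ∀ a b, (a, b) ∈ v.strands → (r a, r b) ∈ v'.strands ∨ (r b, r a) ∈ v'.strands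

theorem Turned.relabel (r : ℕ → ℕ) (v : Vertex) : Turned r v (v.relabel r) := by
  cases v
  · exact ⟨⟨Equiv.refl (Fin 2), by intro j; fin_cases j <;> rfl, fun _ => rfl⟩, .refl _,
      by simp +contextual [Vertex.relabel, Vertex.strands]⟩
  · exact ⟨⟨Equiv.refl (Fin 4), by intro j; fin_cases j <;> rfl, fun _ => rfl⟩, .refl _,
      by rintro x y h
         simp only [Vertex.strands, Vertex.relabel, List.mem_cons, Prod.mk.injEq] at h ⊢
         grind⟩
  · exact ⟨⟨Equiv.refl (Fin 6), by intro j; fin_cases j <;> rfl, fun _ => rfl⟩, .refl _,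
      by rintro x y h
         simp only [Vertex.strands, Vertex.relabel, List.mem_cons, Prod.mk.injEq] at h ⊢
         grind⟩

theorem relabel_id (v : Vertex) : v.relabel id = v := by
  cases v <;> rfl

theorem Turned.refl (v : Vertex) : Turned id v v := by
  simpa [relabel_id] using Turned.relabel id v

theorem Turned.cross (a b c d : ℕ) : Turned id (cross a b c d) (cross c d a b) := by
  refine ⟨⟨(finRotate 4).trans (finRotate 4), ?_, fun _ => rfl⟩, ?_, ?_⟩
  · intro j; fin_cases j <;> rfl
  · rw [List.map_id]
    exact List.perm_append_comm (l₁ := [c, d]) (l₂ := [a, b])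
  · intro x y h
    simp only [Vertex.strands, List.mem_cons, Prod.mk.injEq, id] at h ⊢
    grind

theorem Turned.triple (h : Equiv.Perm (Fin 3)) (a b c d e f : ℕ) :
    Turned id (triple h a b c d e f) (triple (h * finRotate 3) b c d e f a) := by
  -- The new description starts one end later, so positions shift down by one. The strand `a`-`d` is
  -- now read from `d`, a reversal which `Turned` permits.
  refine ⟨⟨(finRotate 6).symm, ?_, ?_⟩, ?_, ?_⟩
  · intro j; fin_cases j <;> rfl
  · intro j; exact ((finRotate 6).symm_apply_apply j).trans ((finRotate 6).apply_symm_apply j).symm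
  · rw [List.map_id]
    exact List.perm_append_comm (l₁ := [b, c, d, e, f]) (l₂ := [a])
  · intro x y h
    simp only [Vertex.strands, List.mem_cons, Prod.mk.injEq, id] at h ⊢
    grind

/-- A bijection of darts that respects the cyclic order at vertices and the pairing into edges
carries face steps to face steps. Injectivity of `r` keeps different edges from being identified. -/
theorem numFaces_congr {r : ℕ → ℕ} (hr : Function.Injective r) {L L' : Code}
    (e : Fin L.length ≃ Fin L'.length) (h : ∀ i, Turned r (L.get i) (L'.get (e i))) :
    L.numFaces = L'.numFaces := by
  choose σ hσ hσ' using fun i => (h i).exists_equiv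
  let Φ : L.Dart ≃ L'.Dart := Equiv.sigmaCongr e σ
  have hlabel : ∀ d, (Φ d).label = r d.label := fun d => hσ d.1 d.2
  have hnext : ∀ d, Φ d.next = (Φ d).next := fun d => by
    change (⟨e d.1, σ d.1 (finRotate _ d.2)⟩ : L'.Dart) = ⟨e d.1, finRotate _ (σ d.1 d.2)⟩
    rw [hσ']
  refine Nat.card_congr (Quot.congr Φ fun d d' => ?_)
  constructor
  · rintro ⟨c, h1, h2, rfl⟩
    exact ⟨Φ c, fun h => h1 (Φ.injective h), by rw [hlabel, hlabel, h2], hnext c⟩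
  · rintro ⟨c, h1, h2, h3⟩
    obtain ⟨c, rfl⟩ := Φ.surjective c
    exact ⟨c, fun h => h1 (by rw [h]), hr (by rw [← hlabel, ← hlabel, h2]),
      Φ.injective (by rw [h3, hnext])⟩

theorem valid_of_perm {L L' : Code} (h : L.Perm L') (hL : valid L = true) : valid L' = true := by
  rw [valid_iff] at hL ⊢
  obtain ⟨h1, h2, h3⟩ := hL
  have hl : L.labels.Perm L'.labels := h.flatMap_right _
  refine ⟨fun a ha => ?_, fun a ha b hb => ?_, ?_⟩
  · rw [← hl.count_eq]
    exact h1 a (hl.mem_iff.2 ha)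
  · exact (h2 a (hl.mem_iff.2 ha) b (hl.mem_iff.2 hb)).mono
      fun _ _ ⟨v, hv, hs⟩ => ⟨v, h.mem_iff.1 hv, hs⟩
  · obtain ⟨e, he⟩ := exists_equiv_get_of_perm h
    have : L.numFaces = L'.numFaces :=
      numFaces_congr (r := id) Function.injective_id e fun i => by rw [he]; exact .refl _
    rw [Code.Planar] at h3 ⊢
    rwa [← hl.length_eq, ← h.length_eq, ← this]

theorem valid_of_turned {r : ℕ → ℕ} (hr : Function.Injective r) {L L' : Code}
    (h : List.Forall₂ (Turned r) L L') (hL : valid L = true) : valid L' = true := by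
  rw [valid_iff] at hL ⊢
  obtain ⟨h1, h2, h3⟩ := hL
  have hl : L'.labels.Perm (L.labels.map r) := by
    clear h1 h2 h3
    induction h with
    | nil => exact .refl _
    | cons hv _ ih =>
      simp only [Code.labels, List.flatMap_cons, List.map_append]
      exact hv.ends_perm.append ih
  have hs : ∀ a b, L.Consecutive a b → L'.Consecutive (r a) (r b) ∨ L'.Consecutive (r b) (r a) := by
    rintro a b ⟨v, hv, hs⟩
    obtain ⟨i, rfl⟩ := List.get_of_mem hv
    have hi := (List.forall₂_iff_get.1 h).2 i i.2 (h.length_eq ▸ i.2)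
    exact (hi.strands a b hs).imp (fun h => ⟨_, List.get_mem _ _, h⟩)
      fun h => ⟨_, List.get_mem _ _, h⟩
  refine ⟨fun a ha => ?_, fun a ha b hb => ?_, ?_⟩
  · rw [hl.count_eq]
    obtain ⟨a, ha', rfl⟩ := List.mem_map.1 (hl.mem_iff.1 ha)
    rw [List.count_map_of_injective _ _ hr]
    exact h1 a ha'
  · obtain ⟨a, ha', rfl⟩ := List.mem_map.1 (hl.mem_iff.1 ha)
    obtain ⟨b, hb', rfl⟩ := List.mem_map.1 (hl.mem_iff.1 hb)
    have := h2 a ha' b hb'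
    clear ha hb ha' hb'
    induction this with
    | rel a b h => exact (hs a b h).elim (.rel _ _) fun h => .symm _ _ (.rel _ _ h)
    | refl => exact .refl _
    | symm _ _ _ ih => exact .symm _ _ ih
    | trans _ _ _ _ _ ih ih' => exact .trans _ _ _ ih ih'
  · have : L.numFaces = L'.numFaces :=
      numFaces_congr hr (finCongr h.length_eq) fun i =>
        (List.forall₂_iff_get.1 h).2 i i.2 (h.length_eq ▸ i.2)
    rw [Code.Planar] at h3 ⊢
    rwa [hl.length_eq, List.length_map, ← h.length_eq, ← this]

theorem valid_relabel {r : ℕ → ℕ} (hr : Function.Injective r) {L : Code} (hL : valid L = true) :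
    valid (L.map (Vertex.relabel r)) = true := by
  refine valid_of_turned hr ?_ hL
  rw [List.forall₂_map_right_iff]
  exact List.forall₂_same.2 fun v _ => .relabel r v

theorem valid_turn {v v' : Vertex} {L : Code} (h : Turned id v v') (hL : valid (v :: L) = true) :
    valid (v' :: L) = true :=
  valid_of_turned Function.injective_id (.cons h (List.forall₂_same.2 fun v _ => .refl v)) hL

/-! ### Transport of the knot type along moves. -/

/-- The code of a marked diagram of the unknot or of a trefoil knot. -/
def Tame (L : Code) : Prop :=
  ∃ D : MarkedDiagram, D.code = L ∧ (D.SameKnot unknot.toMarkedDiagram ∨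
    D.SameKnot leftTrefoil.toMarkedDiagram ∨ D.SameKnot rightTrefoil.toMarkedDiagram)

theorem valid_code (D : MarkedDiagram) : valid D.code = true :=
  (valid_iff _).2 ⟨D.wellFormed, D.oneComponent, D.planar⟩

/-- The new code must be valid to be a link in the chain; the direction of the move is irrelevant
because `SameKnot` is symmetric. -/
theorem Tame.of_move {L L' : Code} (h : Tame L') (hL : valid L = true)
    (hm : Move L L' ∨ Move L' L) : Tame L := by
  obtain ⟨D, rfl, hD⟩ := h
  obtain ⟨h1, h2, h3⟩ := (valid_iff _).1 hL
  have e : MarkedDiagram.SameKnot ⟨L, h1, h2, h3⟩ D :=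
    hm.elim (fun h => .rel _ _ h) fun h => .symm _ _ (.rel _ _ h)
  exact ⟨_, rfl, hD.imp (e.trans _ _ _) (.imp (e.trans _ _ _) (e.trans _ _ _))⟩

theorem Tame.of_perm {L L' : Code} (h : Tame L') (hL : valid L = true) (hp : L.Perm L') :
    Tame L := h.of_move hL (.inl (.perm hp))

/-- The descriptions of an ordinary crossing. -/
def turns : Vertex → List Vertex
  | cross a b c d => [cross a b c d, cross c d a b]
  | v => [v]

theorem eq_or_move_of_mem_turns {v v' : Vertex} (h : v' ∈ turns v) (L : Code) :
    v' = v ∨ Turned id v v' ∧ Move (v :: L) (v' :: L) := by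
  cases v with
  | cross a b c d =>
    simp only [turns, List.mem_cons, List.not_mem_nil, or_false] at h
    rcases h with rfl | rfl
    · exact .inl rfl
    · exact .inr ⟨.cross a b c d, .rotateCross L a b c d⟩
  | point => exact .inl (List.mem_singleton.1 h)
  | triple => exact .inl (List.mem_singleton.1 h)

theorem valid_of_mem_turns {v v' : Vertex} {L : Code} (h : v' ∈ turns v)
    (hL : valid (v :: L) = true) : valid (v' :: L) = true := by
  rcases eq_or_move_of_mem_turns h L with rfl | ⟨h, -⟩
  · exact hL
  · exact valid_turn h hL

theorem Tame.of_turn {v v' : Vertex} {L : Code} (h : Tame (v' :: L)) (hL : valid (v :: L) = true)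
    (hv : v' ∈ turns v) : Tame (v :: L) := by
  rcases eq_or_move_of_mem_turns hv L with rfl | ⟨-, hm⟩
  · exact h
  · exact h.of_move hL (.inl hm)

/-- Moves act on the head of the list, so the second vertex is swapped to the front, turned and
swapped back. -/
theorem Tame.of_turn_turn {v w v' w' : Vertex} {L L₁ : Code} (h : Tame (v' :: w' :: L))
    (hL : valid L₁ = true) (hp : L₁.Perm (v :: w :: L)) (hv : v' ∈ turns v) (hw : w' ∈ turns w) :
    Tame L₁ := by
  have h1 := valid_of_perm hp hL
  have h2 := valid_of_mem_turns hv h1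
  have h3 := valid_of_perm (.swap w v' L) h2
  have h4 := valid_of_mem_turns hw h3
  exact (((h.of_perm h4 (.swap v' w' L)).of_turn h3 hw |>.of_perm h2 (.swap w v' L)).of_turn
    h1 hv).of_perm hL hp

/-- The ways to single out a vertex. -/
def picks : Code → List (Vertex × Code)
  | [] => []
  | v :: L => (v, L) :: (picks L).map fun p => (p.1, v :: p.2)

theorem perm_of_mem_picks {L : Code} {p : Vertex × Code} (h : p ∈ picks L) :
    L.Perm (p.1 :: p.2) := by
  induction L generalizing p with
  | nil => simp [picks] at h
  | cons v L ih =>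
    simp only [picks, List.mem_cons, List.mem_map] at h
    rcases h with rfl | ⟨q, hq, rfl⟩
    · exact .refl _
    · exact ((ih hq).cons v).trans (.swap _ _ _)

/-! ### Normal forms and the end points of the search. -/

/-- Number the labels of a list in the order of their first occurrence. -/
def firstIndex (l : List ℕ) (n : ℕ) : ℕ := if n ∈ l then l.idxOf n else n + l.length

/-- Labels in `l` get values below `l.length`, all others are shifted to at least `l.length`, so the
two ranges are disjoint. -/
theorem firstIndex_injective (l : List ℕ) : Function.Injective (firstIndex l) := by
  intro a b h
  simp only [firstIndex] at h
  split_ifs at h with ha hb hb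
  · exact (List.idxOf_inj ha).1 h
  · have := List.idxOf_lt_length_iff.2 ha
    omega
  · have := List.idxOf_lt_length_iff.2 hb
    omega
  · omega

theorem map_firstIndex (l : List ℕ) : l.map (firstIndex l) = l.map fun a => l.idxOf a :=
  List.map_congr_left fun _ ha => if_pos ha

/-- The code with its edges numbered in the order of their first occurrence. -/
def normalize (L : Code) : Code := L.map (Vertex.relabel (firstIndex L.labels))

theorem move_normalize (L : Code) : Move L (normalize L) :=
  .relabel L _ (firstIndex_injective _)

theorem tame_normalize_iff {L : Code} (hL : valid L = true) : Tame (normalize L) ↔ Tame L :=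
  ⟨fun h => h.of_move hL (.inl (move_normalize L)),
    fun h => h.of_move (valid_relabel (firstIndex_injective _) hL) (.inr (move_normalize L))⟩

/-- The code of the round circle. -/
def isCircle : Code → Bool
  | [point a b] => Nat.beq a b
  | _ => false

theorem tame_of_isCircle {L : Code} (hL : valid L = true) (h : isCircle L = true) : Tame L := by
  match L, h with
  | [point a b], h =>
    obtain rfl := Nat.eq_of_beq_eq_true h
    rw [← tame_normalize_iff hL]
    refine ⟨unknot.toMarkedDiagram, ?_, .inl (.refl _)⟩
    simp [unknot, normalize, Vertex.relabel, firstIndex, Code.labels, ends]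

/-- The diagrams of the trefoil knots with three crossings, with two orders of the crossings. -/
def trefoilCodes : List Code :=
  [[cross 1 4 2 5, cross 3 6 4 1, cross 5 2 6 3], [cross 1 4 2 5, cross 5 2 6 3, cross 3 6 4 1],
    [cross 4 2 5 1, cross 6 4 1 3, cross 2 6 3 5], [cross 4 2 5 1, cross 2 6 3 5, cross 6 4 1 3]]

/-- The code of a trefoil knot with three crossings. -/
def isTrefoil : Code → Bool
  | [u, v, w] => (turns v).any fun v' => (turns w).any fun w' =>
      trefoilCodes.any fun T => decide (normalize T = normalize [u, v', w'])
  | _ => false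

theorem valid_and_tame_of_mem_trefoilCodes {T : Code} (h : T ∈ trefoilCodes) :
    valid T = true ∧ Tame T := by
  have hl := valid_code leftTrefoil.toMarkedDiagram
  have hr := valid_code rightTrefoil.toMarkedDiagram
  have tl : Tame leftTrefoil.code := ⟨_, rfl, .inr (.inl (.refl _))⟩
  have tr : Tame rightTrefoil.code := ⟨_, rfl, .inr (.inr (.refl _))⟩
  have swap : ∀ u v w : Vertex, [u, v, w].Perm [u, w, v] := fun u v w =>
    (List.Perm.swap w v []).cons u
  simp only [trefoilCodes, List.mem_cons, List.not_mem_nil, or_false] at h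
  rcases h with rfl | rfl | rfl | rfl
  · exact ⟨hl, tl⟩
  · have := valid_of_perm (swap _ _ _) hl
    exact ⟨this, tl.of_perm this (swap _ _ _)⟩
  · exact ⟨hr, tr⟩
  · have := valid_of_perm (swap _ _ _) hr
    exact ⟨this, tr.of_perm this (swap _ _ _)⟩

/-- After turning `v` and `w`, equal normal forms mean that the code is a renaming of a listed
trefoil code. Only soundness matters: the test need not recognise every trefoil code. -/
theorem tame_of_isTrefoil {L : Code} (hL : valid L = true) (h : isTrefoil L = true) : Tame L := by
  match L, h with
  | [u, v, w], h =>
    simp only [isTrefoil, List.any_eq_true, decide_eq_true_eq] at h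
    obtain ⟨v', hv, w', hw, T, hT, h⟩ := h
    obtain ⟨h1, h2⟩ := valid_and_tame_of_mem_trefoilCodes hT
    have p1 : [u, v, w].Perm [v, w, u] := List.perm_append_comm (l₁ := [u]) (l₂ := [v, w])
    have p2 : [u, v', w'].Perm [v', w', u] := List.perm_append_comm (l₁ := [u]) (l₂ := [v', w'])
    have h3 := valid_of_mem_turns hw (valid_of_perm (.swap w v' [u])
      (valid_of_mem_turns hv (valid_of_perm p1 hL)))
    have h4 := valid_of_perm (.swap v' w' [u]) h3
    have h5 : Tame [u, v', w'] := by
      rw [← tame_normalize_iff (valid_of_perm p2.symm h4), ← h, tame_normalize_iff h1]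
      exact h2
    exact (h5.of_perm h4 p2.symm).of_turn_turn hL p1 hv hw

/-! ### Simplification by first and second Reidemeister moves. -/

/-- Undo a first Reidemeister move at a crossing. -/
def undoReidemeister1 : Vertex → Code → List Code
  | cross p q r s, L =>
    bif Nat.beq q r then [point p s :: L] else bif Nat.beq p q then [point r s :: L] else
    bif Nat.beq s p then [point r q :: L] else bif Nat.beq r s then [point p q :: L] else []
  | _, _ => []

/-- A kink joins two neighbouring ends. Two of the four positions are the two forms of the move
itself; the other two become these after a half turn of the crossing. -/
theorem Tame.of_undoReidemeister1 {v : Vertex} {L L' : Code} (h : Tame L')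
    (hL : valid (v :: L) = true) (hv : L' ∈ undoReidemeister1 v L) : Tame (v :: L) := by
  match v, hv with
  | cross p q r s, hv =>
    have turn : cross r s p q ∈ turns (cross p q r s) := by simp [turns]
    have hL' := valid_of_mem_turns turn hL
    simp only [undoReidemeister1, Bool.cond_eq_ite, Nat.beq_eq] at hv
    split_ifs at hv with h1 h1 h1 h1
    · subst h1
      rw [List.mem_singleton.1 hv] at h
      exact h.of_move hL (.inr (.reidemeister1 L p s q))
    · subst h1
      rw [List.mem_singleton.1 hv] at h
      exact h.of_move hL (.inr (.reidemeister1' L r s p))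
    · subst h1
      rw [List.mem_singleton.1 hv] at h
      exact (h.of_move hL' (.inr (.reidemeister1 L r q s))).of_turn hL turn
    · subst h1
      rw [List.mem_singleton.1 hv] at h
      exact (h.of_move hL' (.inr (.reidemeister1' L p q r))).of_turn hL turn
    · simp at hv

/-- Undo a second Reidemeister move at two crossings. -/
def undoReidemeister2 : Vertex → Vertex → Code → List Code
  | cross c m n a, cross n' m' d b, L =>
    bif Nat.beq m m' then bif Nat.beq n n' then [point a b :: point c d :: L] else [] else []
  | _, _, _ => []

theorem Tame.of_undoReidemeister2 {v w : Vertex} {L L' : Code} (h : Tame L')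
    (hL : valid (v :: w :: L) = true) (hv : L' ∈ undoReidemeister2 v w L) :
    Tame (v :: w :: L) := by
  match v, w, hv with
  | cross c m n a, cross n' m' d b, hv =>
    simp only [undoReidemeister2, Bool.cond_eq_ite, Nat.beq_eq] at hv
    split_ifs at hv with h1 h2
    · subst h1 h2
      rw [List.mem_singleton.1 hv] at h
      exact h.of_move hL (.inr (.reidemeister2 L a b c d m n))
    · simp at hv
    · simp at hv

/-- Simpler codes that represent the same knot. -/
def reductions : Code → List Code
  | [] => []
  | point a b :: L => bif Nat.beq a b then [] else
      [L.map (Vertex.relabel fun x => bif Nat.beq x b then a else x)]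
  | v :: L =>
      ((picks (v :: L)).flatMap fun p => undoReidemeister1 p.1 p.2) ++
      (picks (v :: L)).flatMap fun p => (picks p.2).flatMap fun q =>
        (turns p.1).flatMap fun v' => (turns q.1).flatMap fun w' => undoReidemeister2 v' w' q.2

theorem Tame.of_mem_reductions {L L' : Code} (h : Tame L') (hL : valid L = true)
    (hL' : L' ∈ reductions L) : Tame L := by
  -- For a code that starts with a crossing of either kind, the reductions are by definition the
  -- list on the left; the case of a leading marked point is treated apart.
  have key : ((picks L).flatMap fun p => undoReidemeister1 p.1 p.2) ++
      ((picks L).flatMap fun p => (picks p.2).flatMap fun q =>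
        (turns p.1).flatMap fun v' => (turns q.1).flatMap fun w' =>
          undoReidemeister2 v' w' q.2) = reductions L → Tame L := by
    intro hk
    rw [← hk, List.mem_append] at hL'
    simp only [List.mem_flatMap] at hL'
    rcases hL' with ⟨p, hp, h1⟩ | ⟨p, hp, q, hq, v', hv, w', hw, h1⟩
    · have hp := perm_of_mem_picks hp
      exact (h.of_undoReidemeister1 (valid_of_perm hp hL) h1).of_perm hL hp
    · have hp := (perm_of_mem_picks hp).trans ((perm_of_mem_picks hq).cons _)
      refine Tame.of_turn_turn (h.of_undoReidemeister2 ?_ h1) hL hp hv hw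
      exact valid_of_perm (.swap _ _ _) (valid_of_mem_turns hw (valid_of_perm (.swap _ _ _)
        (valid_of_mem_turns hv (valid_of_perm hp hL))))
  match L, hL, hL', key with
  | point a b :: L, hL, hL', _ =>
    simp only [reductions, Bool.cond_eq_ite, Nat.beq_eq] at hL'
    split_ifs at hL' with hab
    · simp at hL'
    · rw [List.mem_singleton.1 hL'] at h
      refine h.of_move hL (.inl ?_)
      convert Move.forget L a b hab using 4
      rename_i x
      simp [Function.update_apply]
  | cross a b c d :: L, _, _, key => exact key rfl
  | triple t a b c d e f :: L, _, _, key => exact key rfl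

/-- A search that shows that a code represents the unknot or a trefoil knot. -/
def check : ℕ → Code → Bool
  | 0, _ => false
  | n + 1, L => valid L && match reductions L with
    | [] => isCircle L || isTrefoil L
    | L' :: _ => check n L'

theorem valid_of_check {n : ℕ} {L : Code} (h : check n L = true) : valid L = true := by
  cases n with
  | zero => simp [check] at h
  | succ n => exact (Bool.and_eq_true_iff.1 h).1

/-- The search is greedy and follows only the first reduction. It tests validity at each step, so
the reversed moves join genuine marked diagrams. -/
theorem tame_of_check {n : ℕ} {L : Code} (h : check n L = true) : Tame L := by
  induction n generalizing L with
  | zero => simp [check] at h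
  | succ n ih =>
    have hL := valid_of_check h
    rw [check, Bool.and_eq_true] at h
    replace h := h.2
    split at h
    · rcases Bool.or_eq_true_iff.1 h with h | h
      · exact tame_of_isCircle hL h
      · exact tame_of_isTrefoil hL h
    · rename_i L' _ hr
      exact (ih h).of_mem_reductions hL (by rw [hr]; exact List.mem_cons_self)

/-! ### Enumeration of all diagrams. -/

/-- The resolution of a triple crossing with the strand `a`-`d` at the bottom; `w` says whether
the strand `b`-`e` is below the strand `c`-`f`. -/
def bottomResolution (w : Bool) (a b c d e f x y z : ℕ) : Code :=
  [cross x y d e, cross a z x f, bif w then cross b c y z else cross c y z b]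

/-- The other resolution of such a triple crossing. -/
def bottomResolution' (w : Bool) (a b c d e f x y z : ℕ) : Code :=
  [cross a b x y, cross x c d z, bif w then cross y z e f else cross z e f y]

/-- The strand at the bottom passes under both others, so the heights matter only through the order
of strands `1` and `2`. -/
theorem resolution_eq {h : Equiv.Perm (Fin 3)} (h0 : h 0 = 0) (a b c d e f x y z : ℕ) :
    resolution h a b c d e f x y z =
      bottomResolution (decide (h 1 < h 2)) a b c d e f x y z ∧
    resolution' h a b c d e f x y z =
      bottomResolution' (decide (h 1 < h 2)) a b c d e f x y z := by
  have h1 : h 0 < h 1 := by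
    rw [h0, Fin.pos_iff_ne_zero, ← h0]
    exact fun hc => absurd (h.injective hc) (by decide)
  have h2 : h 0 < h 2 := by
    rw [h0, Fin.pos_iff_ne_zero, ← h0]
    exact fun hc => absurd (h.injective hc) (by decide)
  simp [resolution, resolution', bottomResolution, bottomResolution', crossAt, h1, h2,
    Bool.cond_eq_ite]

/-- The lists of length `n` with at most `m` different numbers, each of which occurs at most twice
and is given by the position where it occurs first. -/
def pairings (m : ℕ) : ℕ → List (List ℕ)
  | 0 => [[]]
  | n + 1 => (pairings m n).flatMap fun t =>
      ((bif Nat.ble m (numValues (t.map fun i => (i, i))) then t else n :: t).filter fun j =>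
        Nat.ble (t.countP fun i => Nat.beq i j) 1).map fun j => t ++ [j]

/-- Reading `l` from the left, each entry is either a label met once before or a new one, numbered
by its own position; these are the choices `pairings` offers. -/
theorem map_idxOf_mem_pairings {m : ℕ} {l : List ℕ} (hm : l.toFinset.card ≤ m)
    (h : ∀ a ∈ l, l.count a = 2) : (l.map fun a => l.idxOf a) ∈ pairings m l.length := by
  suffices H : ∀ k ≤ l.length, ((l.take k).map fun a => l.idxOf a) ∈ pairings m k by
    simpa using H l.length le_rfl
  intro k hk
  induction k with
  | zero => simp [pairings]
  | succ k ih =>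
    simp only [pairings, List.mem_flatMap]
    refine ⟨_, ih (by omega), ?_⟩
    have ht : l.take (k + 1) = l.take k ++ [l[k]] := (List.take_append_getElem hk).symm
    have hmem : l[k] ∈ l := List.getElem_mem hk
    rw [List.mem_map]
    refine ⟨l.idxOf l[k], ?_, by rw [ht, List.map_append]; rfl⟩
    rw [List.mem_filter]
    constructor
    · by_cases hc : l[k] ∈ l.take k
      · have : l.idxOf l[k] ∈ (l.take k).map fun a => l.idxOf a := List.mem_map.2 ⟨_, hc, rfl⟩
        rw [Bool.cond_eq_ite]
        split_ifs
        · exact this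
        · exact List.mem_cons_of_mem _ this
      -- The prefix misses the label `l[k]`, so its labels form a proper subset and a new number is
      -- still allowed.
      · have hlt : numValues (((l.take k).map fun a => l.idxOf a).map fun i => (i, i)) < m := by
          rw [numValues_eq, List.map_map]
          change (((l.take k).map fun a => l.idxOf a).map id).toFinset.card < m
          have himage : ((l.take k).map fun a => l.idxOf a).toFinset =
              (l.take k).toFinset.image fun a => l.idxOf a := by
            ext
            simp [-List.map_take]
          rw [List.map_id, himage]
          refine (Finset.card_image_le.trans_lt (Finset.card_lt_card ?_)).trans_le hm
          refine Finset.ssubset_iff_subset_ne.2 ⟨fun x hx => ?_, fun hx => hc ?_⟩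
          · exact List.mem_toFinset.2 (List.mem_of_mem_take (List.mem_toFinset.1 hx))
          · rw [← List.mem_toFinset, hx]
            exact List.mem_toFinset.2 hmem
        rw [Bool.eq_false_iff.2 fun h => absurd (Nat.ble_eq ▸ h) hlt.not_ge, cond_false]
        refine List.mem_cons.2 (.inl ?_)
        have hl : l = l.take k ++ l[k] :: l.drop (k + 1) := by
          rw [← List.drop_eq_getElem_cons hk, List.take_append_drop]
        have hidx := List.idxOf_append_of_notMem (l₂ := l[k] :: l.drop (k + 1)) hc
        rw [← hl, List.idxOf_cons_self, List.length_take] at hidx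
        omega
    · have hcount : ((l.take k).map fun a => l.idxOf a).countP (fun i => Nat.beq i (l.idxOf l[k]))
          = (l.take k).count l[k] := by
        rw [List.countP_map, List.count]
        refine List.countP_congr fun x hx => ?_
        simp [List.idxOf_inj (List.mem_of_mem_take hx)]
      have h2 : (l.take (k + 1)).count l[k] ≤ 2 :=
        (h _ hmem) ▸ (List.take_sublist _ l).count_le _
      rw [ht, List.count_append, List.count_singleton_self] at h2
      rw [hcount, Nat.ble_eq]
      omega

/-- The search for all diagrams with one triple and one ordinary crossing and given labels. -/
def checkLabels : List ℕ → Bool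
  | [a, b, c, d, e, f, p, q, r, s] =>
    !validEnds [[a, b, c, d, e, f], [p, q, r, s]] || [true, false].all fun w =>
      check 10 (bottomResolution w a b c d e f 10 11 12 ++ [cross p q r s]) ||
      (valid (bottomResolution w a b c d e f 10 11 12 ++ [cross p q r s]) &&
        check 10 (bottomResolution' w a b c d e f 10 11 12 ++ [cross p q r s]))
  | _ => true

set_option maxRecDepth 100000 in
-- The case analysis itself. Ends are numbered by positions `0` to `9`, so `10`, `11`, `12` are free
-- for the edges of the small triangle.
theorem checkLabels_pairings : (pairings 5 10).all checkLabels = true := by decide +kernel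

theorem tame_of_bottom {h : Equiv.Perm (Fin 3)} (h0 : h 0 = 0) {a b c d e f p q r s : ℕ}
    (hL : valid [triple h a b c d e f, cross p q r s] = true) :
    Tame [triple h a b c d e f, cross p q r s] := by
  rw [← tame_normalize_iff hL]
  have hL' : valid (normalize _) = true := valid_relabel (firstIndex_injective _) hL
  have hl : Code.labels [triple h a b c d e f, cross p q r s] =
      [a, b, c, d, e, f, p, q, r, s] := rfl
  have hw := ((valid_iff _).1 hL).1
  rw [normalize, hl] at hL' ⊢
  rw [Code.WellFormed, hl] at hw
  generalize hl' : [a, b, c, d, e, f, p, q, r, s] = l at hL' hw ⊢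
  have hlen : l.length = 10 := by rw [← hl']; rfl
  -- Ten ends, two for each edge.
  have hcard : l.toFinset.card ≤ 5 := by
    have := l.sum_toFinset_count_eq_length
    rw [Finset.sum_congr rfl fun x hx => hw x (List.mem_toFinset.1 hx), Finset.sum_const, hlen,
      smul_eq_mul] at this
    omega
  have hc := List.all_eq_true.1 checkLabels_pairings _ (hlen ▸ map_idxOf_mem_pairings hcard hw)
  rw [← map_firstIndex] at hc
  generalize firstIndex l = g at hL' hc ⊢
  rw [← hl'] at hc
  change validEnds [[g a, g b, g c, g d, g e, g f], [g p, g q, g r, g s]] = true at hL'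
  simp only [List.map_cons, List.map_nil, checkLabels, hL', Bool.not_true, Bool.false_or,
    List.all_eq_true, Bool.or_eq_true, Bool.and_eq_true] at hc
  have hc := hc (decide (h 1 < h 2)) (by cases decide (h 1 < h 2) <;> simp)
  have key := resolution_eq h0 (g a) (g b) (g c) (g d) (g e) (g f) 10 11 12
  rw [← key.1, ← key.2] at hc
  -- The move `resolve` yields only the first resolution; the second is reached through it by a
  -- third Reidemeister move, so the first must be valid in either case.
  have hres : valid (resolution h (g a) (g b) (g c) (g d) (g e) (g f) 10 11 12 ++
      [cross (g p) (g q) (g r) (g s)]) = true := hc.elim valid_of_check And.left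
  refine Tame.of_move ?_ hL' (.inl (.resolve [cross (g p) (g q) (g r) (g s)] h
    (g a) (g b) (g c) (g d) (g e) (g f) 10 11 12))
  rcases hc with hc | hc
  · exact tame_of_check hc
  · exact (tame_of_check hc.2).of_move hres (.inl (.reidemeister3 _ h _ _ _ _ _ _ _ _ _))

theorem Tame.of_rotateTriple {h : Equiv.Perm (Fin 3)} {a b c d e f : ℕ} {L : Code}
    (hL : valid (triple h a b c d e f :: L) = true)
    (H : valid (triple (h * finRotate 3) b c d e f a :: L) = true →
      Tame (triple (h * finRotate 3) b c d e f a :: L)) : Tame (triple h a b c d e f :: L) :=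
  (H (valid_turn (.triple h a b c d e f) hL)).of_move hL (.inl (.rotateTriple L h a b c d e f))

/-- If strand `i` is the bottom one, turning the description by `i` ends makes it strand `0`. -/
theorem tame_triple_cross {h : Equiv.Perm (Fin 3)} {a b c d e f p q r s : ℕ}
    (hL : valid [triple h a b c d e f, cross p q r s] = true) :
    Tame [triple h a b c d e f, cross p q r s] := by
  obtain ⟨i, hi⟩ := h.surjective 0
  fin_cases i
  · exact tame_of_bottom hi hL
  · exact .of_rotateTriple hL fun hL => tame_of_bottom hi hL
  · exact .of_rotateTriple hL fun hL => .of_rotateTriple hL fun hL => tame_of_bottom hi hL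

/-! ### From knot diagrams to codes with two vertices. -/

theorem perm_triple_cross (D : KnotDiagram) (h3 : D.numTriple = 1) (h2 : D.numCross = 1) :
    ∃ h a b c d e f p q r s, D.code.Perm [triple h a b c d e f, cross p q r s] := by
  -- A marked point would be the only vertex, which leaves no room for the triple crossing.
  have hp : ∀ v ∈ D.code, v.isPoint = false := fun v hv => by
    by_contra hc
    rw [Bool.not_eq_false] at hc
    rw [KnotDiagram.numTriple, D.unmarked v hv hc] at h3
    cases v <;> simp [isPoint, isTriple] at hc h3
  rw [KnotDiagram.numTriple] at h3
  rw [KnotDiagram.numCross] at h2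
  obtain ⟨t, ht, htt⟩ := List.countP_pos_iff.1 (h3 ▸ one_pos)
  have hM := List.perm_cons_erase ht
  generalize D.code.erase t = M at hM
  rw [hM.countP_eq] at h2 h3
  cases t with
  | point | cross => simp [isTriple] at htt
  | triple h a b c d e f =>
    rw [List.countP_cons_of_neg (by simp [isCross])] at h2
    rw [List.countP_cons_of_pos htt] at h3
    obtain ⟨x, hx, hxx⟩ := List.countP_pos_iff.1 (h2 ▸ one_pos)
    have hN := List.perm_cons_erase hx
    generalize M.erase x = N at hN
    rw [hN.countP_eq] at h2 h3
    cases x with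
    | point | triple => simp [isCross] at hxx
    | cross p q r s =>
      rw [List.countP_cons_of_pos hxx] at h2
      rw [List.countP_cons_of_neg (by simp [isTriple])] at h3
      have hD := hM.trans (hN.cons _)
      have hnil : N = [] := by
        refine List.eq_nil_iff_forall_not_mem.2 fun v hv => ?_
        have h1 := hp v (hD.mem_iff.2 (by simp [hv]))
        have h2 := List.countP_eq_zero.1 (Nat.succ.inj h2) v hv
        have h3 := List.countP_eq_zero.1 (Nat.succ.inj h3) v hv
        cases v <;> simp [isPoint, isCross, isTriple] at h1 h2 h3
      rw [hnil] at hD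
      exact ⟨h, a, b, c, d, e, f, p, q, r, s, hD⟩

end TripleKnot

theorem mainTheorem6 (D : TripleKnot.KnotDiagram) (h3 : D.numTriple = 1) (h2 : D.numCross = 1) :
    D.SameKnot TripleKnot.unknot ∨ D.SameKnot TripleKnot.leftTrefoil ∨
      D.SameKnot TripleKnot.rightTrefoil := by
  obtain ⟨h, a, b, c, d, e, f, p, q, r, s, hD⟩ := TripleKnot.perm_triple_cross D h3 h2
  have hL := TripleKnot.valid_code D.toMarkedDiagram
  -- A marked diagram with the code of `D` is `D.toMarkedDiagram` itself by proof irrelevance, so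
  -- `hS` is already the claim.
  obtain ⟨⟨L, h1, h2, h3⟩, rfl, hS⟩ :=
    (TripleKnot.tame_triple_cross (TripleKnot.valid_of_perm hD hL)).of_perm hL hD
  exact hS
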